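/- A hypergraph $H=(V,E)$ consists of a finite nonempty vertex set $V$ and a set $E$ of nonempty subsets of $V$; $v(H)=|V|$, and $e_r(H)$ is the number of edges of size $r$. A non-edge of $H$ is a nonempty subset of $V$ that is not in $E$. A strong subgraph of $H$ is a hypergraph $H'=(V',E')$ with $V'\subseteq V$ and $E'\subseteq E$. For $W\subseteq V$, the weak subgraph of $H$ induced by $W$ has vertex set $W$ and edge set $\{e\cap W : e\in E\}\setminus\{\emptyset\}$; a hypergraph contains $H$ as an induced weak subgraph if one of its induced weak subgraphs is isomorphic to $H$. Let $M\in\mathbb N$ and let $\mathbf p=(p_r)_{r\ge1}$, $p_r=p_r(n)\in[0,1]$, with $p_r=0$ for all $r>M$. The random hypergraph $\mathscr H(n,\mathbf p)$ has vertex set $[n]$, and every nonempty $e\subseteq[n]$ is an edge with probability $p_{|e|}$, independently of all other sets. Put $$p'_r=\sum_{j=r}^{M} n^{j-r}p_j\quad(\text{so } p'_r=0 \text{ for } r>M),\qquad \mu_w(H)=n^{v(H)}\prod_{r=1}^{M}(p'_r)^{e_r(H)},\quad 0^0=1 .$$ **Proposition.** Let $H$ be a fixed hypergraph, all of whose edges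 have size at most $M$, that has at least one non-edge, and let $r$ be the size of its smallest non-edge. Suppose that there is a constant $\varepsilon>0$ with $p_r\le 1-\varepsilon$ for all sufficiently large $n$, that $p'_r=O(1)$ as $n\to\infty$, and that $\mu_w(H')\to\infty$ as $n\to\infty$ for every strong subgraph $H'$ of $H$ (with nonempty vertex set). Then asymptotically almost surely $\mathscr H(n,\mathbf p)$ contains $H$ as an induced weak subgraph, that is, the probability of this event tends to $1$ as $n\to\infty$. -/

import Mathlib

open Filter Topology MeasureTheory

namespace Hypergraph

variable {α β : Type*}

/-- `H'` is a strong subgraph of `H`: its vertices are vertices of `H` and its edges are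
edges of `H`. -/
def IsStrongSubgraph (H' H : Hypergraph α) : Prop :=
  H'.vertexSet ⊆ H.vertexSet ∧ H'.edgeSet ⊆ H.edgeSet

/-- The weak subgraph of `G` induced by `W`: its vertex set is `W` and its edges are the traces
`e ∩ W` of the edges `e` of `G`. The empty edge is discarded and edges are not repeated. -/
def weakInduced (G : Hypergraph α) (W : Set α) : Hypergraph α where
  vertexSet := W
  edgeSet := {f | f.Nonempty ∧ ∃ e ∈ G.edgeSet, e ∩ W = f}
  subset_vertexSet_of_mem_edgeSet' := by
    rintro f ⟨-, e, -, rfl⟩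
    exact Set.inter_subset_right

/-- `K` is an induced weak subgraph of `G`. -/
def IsInducedWeakSubgraph (K G : Hypergraph α) : Prop :=
  ∃ W ⊆ G.vertexSet, K = G.weakInduced W

/-- `H` and `K` are isomorphic: an injection of the vertices of `H` carries `H` onto `K`. -/
def Isomorphic (H : Hypergraph α) (K : Hypergraph β) : Prop :=
  ∃ f : α → β, Set.InjOn f H.vertexSet ∧ H.image f = K

/-- `G` contains `H` as an induced weak subgraph, i.e. some induced weak subgraph of `G` is
isomorphic to `H`. -/
def ContainsInducedWeak (G : Hypergraph β) (H : Hypergraph α) : Prop :=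
  ∃ K : Hypergraph β, K.IsInducedWeakSubgraph G ∧ H.Isomorphic K

/-- `e_r(H)`, the number of edges of size `r`. -/
noncomputable def edgeCount (H : Hypergraph α) (r : ℕ) : ℕ :=
  {e | e ∈ H.edgeSet ∧ e.ncard = r}.ncard

/-- The non-edges of `H`: nonempty sets of vertices that are not edges. -/
def nonEdges (H : Hypergraph α) : Set (Set α) :=
  {e | e ⊆ H.vertexSet ∧ e.Nonempty ∧ e ∉ H.edgeSet}

/-- The hypergraph on the vertex set `Fin n` whose edges are the nonempty sets that `ω` selects. -/
def ofIndicator {n : ℕ} (ω : {s : Finset (Fin n) // s.Nonempty} → Bool) :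
    Hypergraph (Fin n) where
  vertexSet := Set.univ
  edgeSet := {e | ∃ s : {s : Finset (Fin n) // s.Nonempty}, ω s = true ∧ (s.1 : Set (Fin n)) = e}
  subset_vertexSet_of_mem_edgeSet' := fun e _ => Set.subset_univ e

instance instMeasurableSpaceFin (n : ℕ) : MeasurableSpace (Hypergraph (Fin n)) := ⊤

/-- The law of the random hypergraph on `n` labelled vertices with edge probabilities
`p = (p_r)_{r ≥ 1}`, `p_r = p r n`: every nonempty set `s` of vertices is an edge with
probability `p_{|s|}`, independently of all the other sets. The value `p 0 n` is not used. -/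
noncomputable def random (p : ℕ → ℕ → unitInterval) (n : ℕ) : Measure (Hypergraph (Fin n)) :=
  (Measure.pi fun s : {s : Finset (Fin n) // s.Nonempty} =>
    ProbabilityTheory.bernoulliMeasure true false (p s.1.card n)).map ofIndicator

instance isProbabilityMeasure_random (p : ℕ → ℕ → unitInterval) (n : ℕ) :
    IsProbabilityMeasure (random p n) :=
  Measure.isProbabilityMeasure_map (measurable_of_finite _).aemeasurable

/-- `p'_r = p_r + n p_{r+1} + n² p_{r+2} + ⋯ + n^{M-r} p_M`, as a function of `n`
(the empty sum `0` if `r > M`). -/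
noncomputable def pPrime (p : ℕ → ℕ → unitInterval) (M r n : ℕ) : ℝ :=
  ∑ j ∈ Finset.Icc r M, (n : ℝ) ^ (j - r) * (p j n : ℝ)

/-- `μ_w(H) = n^{v(H)} ∏_{r=1}^M (p'_r)^{e_r(H)}`, as a function of `n`. -/
noncomputable def muW (p : ℕ → ℕ → unitInterval) (M : ℕ) (H : Hypergraph α) (n : ℕ) : ℝ :=
  (n : ℝ) ^ H.vertexSet.ncard * ∏ r ∈ Finset.Icc 1 M, pPrime p M r n ^ H.edgeCount r

end Hypergraph

/-!
The proof is a second moment argument, arranged so that it needs no bound on the weights `p'_k` of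
the edge sizes `k < r`, which may tend to infinity.

For a fixed `n`, choose for every edge size `k` a size `j_k ≥ k` for which `n^(j_k - k) p_(j_k)` is
the largest term of `p'_k`, hence at least `p'_k / (M + 1)`. Enlarge each edge `f` of `H` by
`j_|f| - |f|` new vertices of its own. An embedding `Φ` of this extended hypergraph into `[n]` is
good (`copyEvent`) if it maps the extended edges to edges and if no edge has as its trace on the
image of `V(H)` the image of a non-edge. A good embedding exhibits `H` as an induced weak subgraph
(`containsInducedWeak_of_mem_copyEvent`), and the number of good embeddings is estimated as follows.

* The sets that `Φ` requires to be edges and those it forbids are different sets, so the probability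
  that `Φ` is good is a product `a · b_Φ`. A forbidden set contains an `r`-subset of the image, so
  the forbidden sets have total probability `O(p'_r) = O(1)`; since `p_k` stays away from `1` for
  `k ≥ r`, the factor `b_Φ` is bounded below (`exp_le_prod_absent`).
* If `Φ` and `Ψ` have disjoint images, they have no required set in common, and a set forbidden by
  both contains one of `O(1)` sets of size `2r`. These common sets have total probability
  `O(p'_(2r)) = O(1 / n)`, so the two events are almost independent
  (`measureReal_inter_le_of_overlap_eq_empty`).
* If the images share `u ≥ 1` vertices, the shared part is a piece of the extended hypergraph, whose
  expected number of copies is, up to a constant, at least `μ_w(H')` for a strong subgraph `H'`, or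
  at least `n`. If all these are at least `L`, the joint probability is at most `a² n^u / L`
  (`measureReal_inter_le_of_overlap_nonempty`), and the sum over all such pairs is `O(1 / L)` times
  the square of the expected number of good embeddings.

The resulting explicit bound for a single `n` is `le_measureReal_iUnion_copyEvent`; letting `n`, and
with it `L`, tend to infinity gives the theorem.
-/

namespace Hypergraph

/-! ### The second moment method for finitely many events -/

/-- If the pair correlations of finitely many events sum to at most `(1 + η)` times the square of
the expected number `m` of events that occur, then some event occurs with probability at least
`1 - η`. -/
theorem one_sub_le_measureReal_iUnion {Ω κ : Type*} [MeasurableSpace Ω] (μ : Measure Ω)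
    [IsProbabilityMeasure μ] [Fintype κ] (A : κ → Set Ω) (hA : ∀ i, MeasurableSet (A i))
    (η : ℝ) (hm : 0 < ∑ i, μ.real (A i))
    (h : ∑ i, ∑ j, μ.real (A i ∩ A j) ≤ (1 + η) * (∑ i, μ.real (A i)) ^ 2) :
    1 - η ≤ μ.real (⋃ i, A i) := by
  classical
  set m := ∑ i, μ.real (A i) with hmdef
  have hU : MeasurableSet (⋃ i, A i) := MeasurableSet.iUnion hA
  have hint : ∀ s : Set Ω, MeasurableSet s → Integrable (s.indicator (fun _ => (1 : ℝ))) μ :=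
    fun s hs => (integrable_const 1).indicator hs
  have hone : ∀ s : Set Ω, MeasurableSet s → ∫ x, s.indicator (fun _ => (1 : ℝ)) x ∂μ = μ.real s :=
    fun s hs => integral_indicator_one hs
  have hI1 : Integrable (fun x => ∑ i, (A i).indicator (fun _ => (1 : ℝ)) x) μ :=
    integrable_finsetSum _ fun i _ => hint _ (hA i)
  have hI2 : Integrable (fun x => ∑ i, ∑ j, (A i ∩ A j).indicator (fun _ => (1 : ℝ)) x) μ :=
    integrable_finsetSum _ fun i _ => integrable_finsetSum _ fun j _ =>
      hint _ ((hA i).inter (hA j))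
  -- No event occurs exactly where the count vanishes, and there `(1 - count / m) ^ 2 = 1`.
  have key : ∀ x, ((⋃ i, A i)ᶜ).indicator (fun _ => (1 : ℝ)) x ≤
      1 - 2 / m * ∑ i, (A i).indicator (fun _ => (1 : ℝ)) x +
        1 / m ^ 2 * ∑ i, ∑ j, (A i ∩ A j).indicator (fun _ => (1 : ℝ)) x := by
    intro x
    have hsq : ∑ i, ∑ j, (A i ∩ A j).indicator (fun _ => (1 : ℝ)) x =
        (∑ i, (A i).indicator (fun _ => (1 : ℝ)) x) ^ 2 := by
      rw [sq, Finset.sum_mul_sum]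
      refine Finset.sum_congr rfl fun i _ => Finset.sum_congr rfl fun j _ => ?_
      by_cases hi : x ∈ A i <;> by_cases hj : x ∈ A j <;> simp [hi, hj]
    rw [hsq]
    by_cases hx : x ∈ ⋃ i, A i
    · rw [Set.indicator_of_notMem (by simpa using hx)]
      have := sq_nonneg (1 - (∑ i, (A i).indicator (fun _ => (1 : ℝ)) x) / m)
      refine this.trans_eq ?_
      field_simp
      ring
    · have h0 : ∑ i, (A i).indicator (fun _ => (1 : ℝ)) x = 0 :=
        Finset.sum_eq_zero fun i _ => Set.indicator_of_notMem
          (fun hi => hx (Set.mem_iUnion.2 ⟨i, hi⟩)) _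
      rw [Set.indicator_of_mem hx, h0]
      simp
  have hint2 := integral_mono (hint _ hU.compl)
    (((integrable_const (1 : ℝ)).sub (hI1.const_mul (2 / m))).add (hI2.const_mul (1 / m ^ 2))) key
  rw [hone _ hU.compl] at hint2
  have e1 : ∫ x, (1 - 2 / m * ∑ i, (A i).indicator (fun _ => (1 : ℝ)) x +
        1 / m ^ 2 * ∑ i, ∑ j, (A i ∩ A j).indicator (fun _ => (1 : ℝ)) x) ∂μ =
      1 - 2 / m * m + 1 / m ^ 2 * ∑ i, ∑ j, μ.real (A i ∩ A j) := by
    have hsub : Integrable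
        (fun x => 1 - 2 / m * ∑ i, (A i).indicator (fun _ => (1 : ℝ)) x) μ :=
      (integrable_const (1 : ℝ)).sub (hI1.const_mul (2 / m))
    rw [integral_add hsub (hI2.const_mul (1 / m ^ 2)),
      integral_sub (integrable_const (1 : ℝ)) (hI1.const_mul (2 / m)),
      integral_const_mul, integral_const_mul, integral_finsetSum _ fun i _ => hint _ (hA i),
      integral_finsetSum _ fun i _ => integrable_finsetSum _ fun j _ =>
        hint _ ((hA i).inter (hA j))]
    simp only [hone _ (hA _)]
    congr 1
    · simp [hmdef]
    · congr 1
      refine Finset.sum_congr rfl fun i _ => ?_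
      rw [integral_finsetSum _ fun j _ => hint _ ((hA i).inter (hA j))]
      simp only [hone _ ((hA _).inter (hA _))]
  have hint3 : μ.real (⋃ i, A i)ᶜ ≤ 1 - 2 / m * m + 1 / m ^ 2 * ∑ i, ∑ j, μ.real (A i ∩ A j) :=
    hint2.trans_eq e1
  rw [probReal_compl_eq_one_sub hU] at hint3
  have h4 : 1 / m ^ 2 * ∑ i, ∑ j, μ.real (A i ∩ A j) ≤ 1 + η := by
    rw [one_div_mul_eq_div, div_le_iff₀ (by positivity)]
    exact h
  have h5 : 2 / m * m = 2 := by field_simp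
  linarith

/-! ### Prescribing the presence and the absence of edges -/

/-- The law of the independent edge indicators when a set of size `k` is an edge with
probability `q k`. -/
noncomputable def indicatorMeasure (q : ℕ → unitInterval) (n : ℕ) :
    Measure ({s : Finset (Fin n) // s.Nonempty} → Bool) :=
  Measure.pi fun s => ProbabilityTheory.bernoulliMeasure true false (q s.1.card)

instance (q : ℕ → unitInterval) (n : ℕ) : IsProbabilityMeasure (indicatorMeasure q n) := by
  unfold indicatorMeasure; infer_instance

/-- The event that all sets in `S` are edges and no set in `T` is one. -/
def cylinder {n : ℕ} (S T : Finset (Finset (Fin n))) :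
    Set ({s : Finset (Fin n) // s.Nonempty} → Bool) :=
  {ω | ∀ s, (s.1 ∈ S → ω s = true) ∧ (s.1 ∈ T → ω s = false)}

theorem cylinder_inter {n : ℕ} (S T S' T' : Finset (Finset (Fin n))) :
    cylinder S T ∩ cylinder S' T' = cylinder (S ∪ S') (T ∪ T') := by
  ext ω
  simp only [cylinder, Set.mem_inter_iff, Set.mem_ofPred_eq, Finset.mem_union]
  grind

theorem measureReal_cylinder {n : ℕ} (q : ℕ → unitInterval) (S T : Finset (Finset (Fin n)))
    (hS : ∅ ∉ S) (hT : ∅ ∉ T) (hST : Disjoint S T) :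
    (indicatorMeasure q n).real (cylinder S T) =
      (∏ s ∈ S, (q s.card : ℝ)) * ∏ t ∈ T, (1 - (q t.card : ℝ)) := by
  classical
  have hbox : cylinder S T = Set.pi Set.univ fun s : {s : Finset (Fin n) // s.Nonempty} =>
      {b : Bool | (s.1 ∈ S → b = true) ∧ (s.1 ∈ T → b = false)} := by
    ext ω; simp [cylinder]
  set g : Finset (Fin n) → ℝ := fun s => if s ∈ S then (q s.card : ℝ) else
    if s ∈ T then 1 - (q s.card : ℝ) else 1 with hg
  have hfac : ∀ s : {s : Finset (Fin n) // s.Nonempty},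
      (ProbabilityTheory.bernoulliMeasure true false (q s.1.card)).real
        {b : Bool | (s.1 ∈ S → b = true) ∧ (s.1 ∈ T → b = false)} = g s.1 := by
    intro s
    rw [ProbabilityTheory.bernoulliMeasure_real_apply _ (MeasurableSet.of_discrete)]
    have : s.1 ∈ S → s.1 ∉ T := fun h => Finset.disjoint_left.1 hST h
    by_cases h1 : s.1 ∈ S <;> by_cases h2 : s.1 ∈ T <;> simp_all
  have h1 : (indicatorMeasure q n).real (cylinder S T) =
      ∏ s : {s : Finset (Fin n) // s.Nonempty}, g s.1 := by
    rw [hbox, indicatorMeasure, measureReal_def, Measure.pi_pi, ENNReal.toReal_prod]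
    exact Finset.prod_congr rfl fun s _ => hfac s
  have h2 : ∏ s : {s : Finset (Fin n) // s.Nonempty}, g s.1 = ∏ s, g s := by
    rw [← Finset.prod_subtype (Finset.univ.filter Finset.Nonempty) (by simp) g]
    refine Finset.prod_subset (Finset.subset_univ _) fun s _ hs => ?_
    have : s = ∅ := by simpa using hs
    simp [hg, this, hS, hT]
  have h3 : ∀ s, g s = (if s ∈ S then (q s.card : ℝ) else 1) *
      (if s ∈ T then 1 - (q s.card : ℝ) else 1) := by
    intro s
    have : s ∈ S → s ∉ T := fun h => Finset.disjoint_left.1 hST h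
    by_cases h1 : s ∈ S <;> by_cases h2 : s ∈ T <;> simp_all
  rw [h1, h2, Finset.prod_congr rfl fun s _ => h3 s, Finset.prod_mul_distrib]
  simp [Finset.prod_ite_mem]

theorem measureReal_cylinder_le {n : ℕ} (q : ℕ → unitInterval) (S T : Finset (Finset (Fin n)))
    (hS : ∅ ∉ S) (hT : ∅ ∉ T) :
    (indicatorMeasure q n).real (cylinder S T) ≤
      (∏ s ∈ S, (q s.card : ℝ)) * ∏ t ∈ T, (1 - (q t.card : ℝ)) := by
  by_cases hST : Disjoint S T
  · exact (measureReal_cylinder q S T hS hT hST).le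
  · obtain ⟨s, h1, h2⟩ := Finset.not_disjoint_iff.1 hST
    have : cylinder S T = ∅ := by
      refine Set.eq_empty_of_forall_notMem fun ω hω => ?_
      have hs : s.Nonempty := Finset.nonempty_iff_ne_empty.2 fun h => hS (h ▸ h1)
      have := hω ⟨s, hs⟩
      simp_all
    rw [this, measureReal_empty]
    exact mul_nonneg (Finset.prod_nonneg fun s _ => (q _).2.1)
      (Finset.prod_nonneg fun s _ => sub_nonneg.2 (q _).2.2)

/-! ### Sums of edge probabilities over all supersets of a given set -/

/-- `∑_{j=k}^{M} n^{j-k} q_j`, the quantity `pPrime` for a single value of `n`. -/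
noncomputable def superWeight (q : ℕ → unitInterval) (M n k : ℕ) : ℝ :=
  ∑ j ∈ Finset.Icc k M, (n : ℝ) ^ (j - k) * (q j : ℝ)

theorem superWeight_nonneg (q : ℕ → unitInterval) (M n k : ℕ) : 0 ≤ superWeight q M n k :=
  Finset.sum_nonneg fun j _ => mul_nonneg (by positivity) (q j).2.1

theorem superWeight_add_le (q : ℕ → unitInterval) (M n k i : ℕ) :
    (n : ℝ) ^ i * superWeight q M n (k + i) ≤ superWeight q M n k := by
  unfold superWeight
  rw [Finset.mul_sum]
  refine (Finset.sum_le_sum (fun j hj => ?_)).trans (Finset.sum_le_sum_of_subset_of_nonneg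
    (Finset.Icc_subset_Icc_left (Nat.le_add_right k i)) fun j _ _ =>
      mul_nonneg (by positivity) (q j).2.1)
  rw [← mul_assoc, ← pow_add]
  have := (Finset.mem_Icc.1 hj).1
  rw [show i + (j - (k + i)) = j - k by omega]

/-- At most `n ^ (j - |R|)` sets of size `j` contain `R`; beyond the size `M` they do not count. -/
theorem sum_superset_le (q : ℕ → unitInterval) (M n : ℕ) (hqM : ∀ j, M < j → q j = 0)
    (R : Finset (Fin n)) :
    ∑ s with R ⊆ s, (q s.card : ℝ) ≤ superWeight q M n R.card := by
  classical
  have hmaps : ∀ s ∈ (Finset.univ.filter (R ⊆ ·)).filter (fun s => s.card ≤ M),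
      s.card ∈ Finset.Icc R.card M := by
    intro s hs
    simp only [Finset.mem_filter, Finset.mem_univ, true_and] at hs
    exact Finset.mem_Icc.2 ⟨Finset.card_le_card hs.1, hs.2⟩
  have h0 : ∑ s with R ⊆ s, (q s.card : ℝ) =
      ∑ s ∈ (Finset.univ.filter (R ⊆ ·)).filter (fun s => s.card ≤ M), (q s.card : ℝ) := by
    refine (Finset.sum_filter_of_ne fun s _ hs => ?_).symm
    by_contra hc
    exact hs (by rw [hqM _ (not_le.1 hc)]; rfl)
  rw [h0, ← Finset.sum_fiberwise_of_maps_to hmaps]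
  refine Finset.sum_le_sum fun j _ => ?_
  rw [Finset.sum_congr rfl (g := fun _ => (q j : ℝ)) fun s hs => by
    rw [(Finset.mem_filter.1 hs).2], Finset.sum_const, nsmul_eq_mul]
  refine mul_le_mul_of_nonneg_right ?_ (q j).2.1
  -- A superset of `R` of size `j` is determined by its `j - |R|` further elements.
  have hc : (((Finset.univ.filter (R ⊆ ·)).filter (fun s => s.card ≤ M)).filter
      (fun s => s.card = j)).card ≤
      (Finset.powersetCard (j - R.card) (Finset.univ : Finset (Fin n))).card := by
    refine Finset.card_le_card_of_injOn (fun s => s \ R) (fun s hs => ?_) fun s hs t ht hst => ?_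
    · simp only [Finset.coe_filter, Finset.mem_filter, Finset.mem_univ, true_and,
        Set.mem_ofPred_eq] at hs
      simp [Finset.card_sdiff_of_subset hs.1.1, hs.2]
    · simp only [Finset.coe_filter, Finset.mem_filter, Finset.mem_univ, true_and,
        Set.mem_ofPred_eq] at hs ht
      have hst' : s \ R = t \ R := hst
      rw [← Finset.sdiff_union_of_subset hs.1.1, hst', Finset.sdiff_union_of_subset ht.1.1]
  rw [Finset.card_powersetCard, Finset.card_univ, Fintype.card_fin] at hc
  exact_mod_cast hc.trans (Nat.choose_le_pow _ _)

/-- If every member of `T` contains one of the sets `R` in `𝓡`, all of size `k`, then the expected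
number of edges in `T` is at most `|𝓡|` times the weight of the supersets of a `k`-set. -/
theorem sum_le_card_mul_superWeight (q : ℕ → unitInterval) (M n k : ℕ)
    (hqM : ∀ j, M < j → q j = 0) (T 𝓡 : Finset (Finset (Fin n))) (hcard : ∀ R ∈ 𝓡, R.card = k)
    (hT : ∀ t ∈ T, ∃ R ∈ 𝓡, R ⊆ t) :
    ∑ t ∈ T, (q t.card : ℝ) ≤ 𝓡.card * superWeight q M n k := by
  classical
  calc ∑ t ∈ T, (q t.card : ℝ)
      ≤ ∑ t ∈ 𝓡.biUnion fun R => Finset.univ.filter (R ⊆ ·), (q t.card : ℝ) :=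
        Finset.sum_le_sum_of_subset_of_nonneg (fun t ht => by simpa using hT t ht)
          fun t _ _ => (q _).2.1
    _ ≤ ∑ R ∈ 𝓡, ∑ t with R ⊆ t, (q t.card : ℝ) := by
        clear hcard hT
        induction 𝓡 using Finset.induction_on with
        | empty => simp
        | insert R 𝓡 hR ih =>
          rw [Finset.biUnion_insert, Finset.sum_insert hR]
          refine le_trans ?_ (add_le_add_right ih _)
          rw [← Finset.sum_union_inter]
          exact le_add_of_nonneg_right (Finset.sum_nonneg fun t _ => (q _).2.1)
    _ ≤ ∑ R ∈ 𝓡, superWeight q M n k :=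
        Finset.sum_le_sum fun R hR => by
          rw [← hcard R hR]; exact sum_superset_le q M n hqM R
    _ = _ := by rw [Finset.sum_const, nsmul_eq_mul]

/-! ### Lower bounds for the probability that no set of a family is an edge -/

theorem exp_neg_div_le_one_sub {x ε : ℝ} (hε : 0 < ε) (hx0 : 0 ≤ x) (hx : x ≤ 1 - ε) :
    Real.exp (-(x / ε)) ≤ 1 - x := by
  have hpos : 0 < 1 - x := by linarith
  rw [← Real.le_log_iff_exp_le hpos]
  refine le_trans ?_ (Real.one_sub_inv_le_log_of_pos hpos)
  have h1 : (1 - x)⁻¹ - 1 = x / (1 - x) := by field_simp; ring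
  have h2 : x / (1 - x) ≤ x / ε := div_le_div_of_nonneg_left hx0 hε (by linarith)
  linarith

theorem exp_neg_le_prod_one_sub {ι : Type*} (T : Finset ι) (w : ι → ℝ) {ε : ℝ} (hε : 0 < ε)
    (h0 : ∀ t ∈ T, 0 ≤ w t) (h1 : ∀ t ∈ T, w t ≤ 1 - ε) :
    Real.exp (-((∑ t ∈ T, w t) / ε)) ≤ ∏ t ∈ T, (1 - w t) := by
  rw [Finset.sum_div, ← Finset.sum_neg_distrib, Real.exp_sum]
  exact Finset.prod_le_prod (fun t _ => (Real.exp_pos _).le) fun t ht =>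
    exp_neg_div_le_one_sub hε (h0 t ht) (h1 t ht)

/-! ### Extended copies of a hypergraph -/

section Extension

set_option linter.unusedSectionVars false

variable {τ : Type*} [Fintype τ] [DecidableEq τ] {M n : ℕ}

/-- The vertices of the extended hypergraph: those of the original hypergraph on `τ`, and for each
set of them `M` further vertices. Its edges do not use all of the further vertices; taking
them all makes the vertex type independent of the sizes of the extended edges. -/
abbrev ExtVertex (τ : Type*) (M : ℕ) := τ ⊕ (Finset τ × Fin M)

/-- The new vertices that are added to `f` in order to obtain a set of size `j |f|`. -/
def extraVertices (M : ℕ) (j : ℕ → ℕ) (f : Finset τ) : Finset (Finset τ × Fin M) :=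
  {f} ×ˢ Finset.univ.filter fun i : Fin M => i.val < j f.card - f.card

/-- The set `f` together with its own new vertices. -/
def extension (M : ℕ) (j : ℕ → ℕ) (f : Finset τ) : Finset (ExtVertex τ M) :=
  f.disjSum (extraVertices M j f)

theorem card_extraVertices {j : ℕ → ℕ} {f : Finset τ} (h2 : j f.card ≤ M) :
    (extraVertices M j f).card = j f.card - f.card := by
  rw [extraVertices, Finset.card_product, Finset.card_singleton, one_mul, Fin.card_filter_val_lt]
  omega

theorem card_extension {j : ℕ → ℕ} {f : Finset τ} (h1 : f.card ≤ j f.card) (h2 : j f.card ≤ M) :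
    (extension M j f).card = j f.card := by
  rw [extension, Finset.card_disjSum, card_extraVertices h2]
  omega

/-- The restriction of an embedding of the extended vertices to the original vertices. -/
def baseEmb (Φ : ExtVertex τ M ↪ Fin n) : τ ↪ Fin n := Function.Embedding.inl.trans Φ

/-- The image of the original vertices. -/
def base (Φ : ExtVertex τ M ↪ Fin n) : Finset (Fin n) := Finset.univ.map (baseEmb Φ)

/-- The images of the extended edges. -/
def present (j : ℕ → ℕ) (E : Finset (Finset τ)) (Φ : ExtVertex τ M ↪ Fin n) :
    Finset (Finset (Fin n)) :=
  E.image fun f => (extension M j f).map Φ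

/-- The sets whose trace on the copy of the original vertices is the image of a set in `N`. -/
def absent (N : Finset (Finset τ)) (Φ : ExtVertex τ M ↪ Fin n) : Finset (Finset (Fin n)) :=
  Finset.univ.filter fun s => ∃ g ∈ N, s ∩ base Φ = g.map (baseEmb Φ)

theorem map_extension_inter_base (j : ℕ → ℕ) (Φ : ExtVertex τ M ↪ Fin n) (f : Finset τ) :
    (extension M j f).map Φ ∩ base Φ = f.map (baseEmb Φ) := by
  ext x
  simp only [Finset.mem_inter, Finset.mem_map, base, baseEmb, extension, Finset.mem_univ, true_and,
    Function.Embedding.trans_apply, Function.Embedding.inl_apply]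
  constructor
  · rintro ⟨⟨b, hb, rfl⟩, v, hv⟩
    have := Φ.injective hv
    subst this
    exact ⟨v, by simpa using hb, rfl⟩
  · rintro ⟨v, hv, rfl⟩
    exact ⟨⟨Sum.inl v, by simpa using hv, rfl⟩, v, rfl⟩

theorem map_extension_injective (j : ℕ → ℕ) (Φ : ExtVertex τ M ↪ Fin n) :
    Function.Injective fun f : Finset τ => (extension M j f).map Φ := by
  intro f f' h
  have h' : (extension M j f).map Φ = (extension M j f').map Φ := h
  have := map_extension_inter_base j Φ f
  rw [h', map_extension_inter_base] at this
  exact (Finset.map_injective _ this).symm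

theorem extension_nonempty {j : ℕ → ℕ} {f : Finset τ} (hf : f.Nonempty) :
    (extension M j f).Nonempty := by
  obtain ⟨v, hv⟩ := hf
  exact ⟨Sum.inl v, by simpa [extension] using hv⟩

theorem empty_notMem_present {j : ℕ → ℕ} {E : Finset (Finset τ)} (hE : ∅ ∉ E)
    (Φ : ExtVertex τ M ↪ Fin n) : ∅ ∉ present j E Φ := by
  intro h
  obtain ⟨f, hf, h0⟩ := Finset.mem_image.1 h
  have hne : f.Nonempty := Finset.nonempty_iff_ne_empty.2 fun h => hE (h ▸ hf)
  exact (extension_nonempty hne).ne_empty (Finset.map_eq_empty.1 h0)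

theorem empty_notMem_absent {N : Finset (Finset τ)} (hN : ∅ ∉ N)
    (Φ : ExtVertex τ M ↪ Fin n) : ∅ ∉ absent N Φ := by
  intro h
  obtain ⟨-, g, hg, h0⟩ := Finset.mem_filter.1 h
  rw [Finset.empty_inter, eq_comm, Finset.map_eq_empty] at h0
  exact hN (h0 ▸ hg)

theorem disjoint_present_absent {E N : Finset (Finset τ)} (hEN : Disjoint E N) (j : ℕ → ℕ)
    (Φ : ExtVertex τ M ↪ Fin n) : Disjoint (present j E Φ) (absent N Φ) := by
  rw [Finset.disjoint_left]
  intro s hs ht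
  obtain ⟨f, hf, rfl⟩ := Finset.mem_image.1 hs
  obtain ⟨-, g, hg, h0⟩ := Finset.mem_filter.1 ht
  rw [map_extension_inter_base] at h0
  exact Finset.disjoint_left.1 hEN hf ((Finset.map_injective _ h0) ▸ hg)

theorem prod_image_map_extension (q : ℕ → unitInterval) {j : ℕ → ℕ} {F : Finset (Finset τ)}
    (hj : ∀ f ∈ F, f.card ≤ j f.card ∧ j f.card ≤ M) (Φ : ExtVertex τ M ↪ Fin n) :
    ∏ s ∈ F.image (fun f => (extension M j f).map Φ), (q s.card : ℝ) =
      ∏ f ∈ F, (q (j f.card) : ℝ) := by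
  rw [Finset.prod_image fun f _ f' _ h => map_extension_injective j Φ h]
  refine Finset.prod_congr rfl fun f hf => ?_
  rw [Finset.card_map, card_extension (hj f hf).1 (hj f hf).2]

theorem card_base (Φ : ExtVertex τ M ↪ Fin n) : (base Φ).card = Fintype.card τ := by
  rw [base, Finset.card_map, Finset.card_univ]

theorem exists_subset_of_mem_absent {N : Finset (Finset τ)} {r : ℕ} (hr : ∀ g ∈ N, r ≤ g.card)
    {Φ : ExtVertex τ M ↪ Fin n} {t : Finset (Fin n)} (ht : t ∈ absent N Φ) :
    ∃ R ∈ (base Φ).powersetCard r, R ⊆ t := by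
  obtain ⟨-, g, hg, h0⟩ := Finset.mem_filter.1 ht
  have h1 : r ≤ (t ∩ base Φ).card := by rw [h0, Finset.card_map]; exact hr g hg
  obtain ⟨R, hR, hc⟩ := Finset.exists_subset_card_eq h1
  exact ⟨R, Finset.mem_powersetCard.2 ⟨hR.trans Finset.inter_subset_right, hc⟩,
    hR.trans Finset.inter_subset_left⟩

theorem card_powersetCard_base_le (Φ : ExtVertex τ M ↪ Fin n) (r : ℕ) :
    ((base Φ).powersetCard r).card ≤ 2 ^ Fintype.card τ := by
  rw [Finset.card_powersetCard, card_base]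
  exact Nat.choose_le_two_pow _ _

theorem le_card_of_mem_absent {N : Finset (Finset τ)} {r : ℕ} (hr : ∀ g ∈ N, r ≤ g.card)
    {Φ : ExtVertex τ M ↪ Fin n} {t : Finset (Fin n)} (ht : t ∈ absent N Φ) : r ≤ t.card := by
  obtain ⟨R, hR, hRt⟩ := exists_subset_of_mem_absent hr ht
  rw [← (Finset.mem_powersetCard.1 hR).2]
  exact Finset.card_le_card hRt

/-- With probability bounded away from `0`, none of the sets with a forbidden trace is an edge:
their expected number is at most `2 ^ v` times the weight of the supersets of an `r`-set. -/
theorem exp_le_prod_absent (q : ℕ → unitInterval) (hqM : ∀ j, M < j → q j = 0)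
    {N : Finset (Finset τ)} {r : ℕ} (hr : ∀ g ∈ N, r ≤ g.card) {ε : ℝ} (hε : 0 < ε)
    (hq : ∀ k, r ≤ k → (q k : ℝ) ≤ 1 - ε) (Φ : ExtVertex τ M ↪ Fin n) :
    Real.exp (-(2 ^ Fintype.card τ * superWeight q M n r / ε)) ≤
      ∏ t ∈ absent N Φ, (1 - (q t.card : ℝ)) := by
  refine le_trans ?_ (exp_neg_le_prod_one_sub (absent N Φ) _ hε (fun t _ => (q _).2.1)
    fun t ht => hq _ (le_card_of_mem_absent hr ht))
  refine Real.exp_le_exp.2 (neg_le_neg (div_le_div_of_nonneg_right ?_ hε.le))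
  refine (sum_le_card_mul_superWeight q M n r hqM (absent N Φ) ((base Φ).powersetCard r)
    (fun R hR => (Finset.mem_powersetCard.1 hR).2)
    fun t ht => exists_subset_of_mem_absent hr ht).trans ?_
  refine mul_le_mul_of_nonneg_right ?_ (superWeight_nonneg _ _ _ _)
  exact_mod_cast card_powersetCard_base_le Φ r

/-- A set with forbidden traces on two disjoint copies contains an `r`-subset of each, so that few
of these sets are expected to be edges. -/
theorem exp_le_prod_absent_inter (q : ℕ → unitInterval) (hqM : ∀ j, M < j → q j = 0)
    {N : Finset (Finset τ)} {r : ℕ} (hr : ∀ g ∈ N, r ≤ g.card) {ε : ℝ} (hε : 0 < ε)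
    (hq : ∀ k, r ≤ k → (q k : ℝ) ≤ 1 - ε) (Φ Ψ : ExtVertex τ M ↪ Fin n)
    (hdisj : Disjoint (base Φ) (base Ψ)) :
    Real.exp (-(4 ^ Fintype.card τ * superWeight q M n (r + r) / ε)) ≤
      ∏ t ∈ absent N Φ ∩ absent N Ψ, (1 - (q t.card : ℝ)) := by
  refine le_trans ?_ (exp_neg_le_prod_one_sub (absent N Φ ∩ absent N Ψ) _ hε
    (fun t _ => (q _).2.1)
    fun t ht => hq _ (le_card_of_mem_absent hr (Finset.mem_inter.1 ht).1))
  refine Real.exp_le_exp.2 (neg_le_neg (div_le_div_of_nonneg_right ?_ hε.le))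
  refine (sum_le_card_mul_superWeight q M n (r + r) hqM _
    (Finset.image₂ (· ∪ ·) ((base Φ).powersetCard r) ((base Ψ).powersetCard r))
    (fun R hR => ?_) fun t ht => ?_).trans ?_
  · obtain ⟨R₁, h1, R₂, h2, rfl⟩ := Finset.mem_image₂.1 hR
    rw [Finset.mem_powersetCard] at h1 h2
    rw [Finset.card_union_of_disjoint (Finset.disjoint_of_subset_left h1.1
      (Finset.disjoint_of_subset_right h2.1 hdisj)), h1.2, h2.2]
  · obtain ⟨ht1, ht2⟩ := Finset.mem_inter.1 ht
    obtain ⟨R₁, h1, h1t⟩ := exists_subset_of_mem_absent hr ht1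
    obtain ⟨R₂, h2, h2t⟩ := exists_subset_of_mem_absent hr ht2
    exact ⟨R₁ ∪ R₂, Finset.mem_image₂_of_mem h1 h2, Finset.union_subset h1t h2t⟩
  · refine mul_le_mul_of_nonneg_right ?_ (superWeight_nonneg _ _ _ _)
    have h := (Finset.card_image₂_le (· ∪ ·) ((base Φ).powersetCard r)
      ((base Ψ).powersetCard r)).trans
      (Nat.mul_le_mul (card_powersetCard_base_le Φ r) (card_powersetCard_base_le Ψ r))
    rw [← mul_pow] at h
    exact_mod_cast h

/-! ### Probabilities of one and of two extended copies -/

/-- The event that `Φ` maps every extended edge to an edge, and that no edge has a forbidden trace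
on the image of the original vertices. -/
def copyEvent (j : ℕ → ℕ) (E N : Finset (Finset τ)) (Φ : ExtVertex τ M ↪ Fin n) :
    Set ({s : Finset (Fin n) // s.Nonempty} → Bool) :=
  cylinder (present j E Φ) (absent N Φ)

/-- The extended vertices that `Ψ` maps into the image of `Φ`. -/
def overlap (Φ Ψ : ExtVertex τ M ↪ Fin n) : Finset (ExtVertex τ M) :=
  Finset.univ.filter fun b => Ψ b ∈ Finset.univ.map Φ

theorem measureReal_copyEvent (q : ℕ → unitInterval) {j : ℕ → ℕ} {E N : Finset (Finset τ)}
    (hE : ∅ ∉ E) (hN : ∅ ∉ N) (hEN : Disjoint E N)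
    (hj : ∀ f ∈ E, f.card ≤ j f.card ∧ j f.card ≤ M) (Φ : ExtVertex τ M ↪ Fin n) :
    (indicatorMeasure q n).real (copyEvent j E N Φ) =
      (∏ f ∈ E, (q (j f.card) : ℝ)) * ∏ t ∈ absent N Φ, (1 - (q t.card : ℝ)) := by
  rw [copyEvent, measureReal_cylinder q _ _ (empty_notMem_present hE Φ) (empty_notMem_absent hN Φ)
    (disjoint_present_absent hEN j Φ), present, prod_image_map_extension q hj]

theorem disjoint_map_of_overlap_eq_empty {Φ Ψ : ExtVertex τ M ↪ Fin n} (h : overlap Φ Ψ = ∅)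
    (A B : Finset (ExtVertex τ M)) : Disjoint (A.map Φ) (B.map Ψ) := by
  rw [Finset.disjoint_left]
  intro x hx hy
  obtain ⟨b, -, rfl⟩ := Finset.mem_map.1 hy
  have hb : b ∈ overlap Φ Ψ :=
    Finset.mem_filter.2 ⟨Finset.mem_univ _, Finset.map_subset_map.2 (Finset.subset_univ A) hx⟩
  simp [h] at hb

theorem base_eq_map (Φ : ExtVertex τ M ↪ Fin n) :
    base Φ = (Finset.univ.map Function.Embedding.inl).map Φ := by
  rw [Finset.map_map]; rfl

theorem prod_one_sub_nonneg (q : ℕ → unitInterval) (T : Finset (Finset (Fin n))) :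
    0 ≤ ∏ t ∈ T, (1 - (q t.card : ℝ)) :=
  Finset.prod_nonneg fun _ _ => sub_nonneg.2 (q _).2.2

theorem prod_one_sub_le_one (q : ℕ → unitInterval) (T : Finset (Finset (Fin n))) :
    ∏ t ∈ T, (1 - (q t.card : ℝ)) ≤ 1 :=
  Finset.prod_le_one (fun _ _ => sub_nonneg.2 (q _).2.2) fun _ _ => sub_le_self _ (q _).2.1

/-- Two copies with disjoint images are almost independent. -/
theorem measureReal_inter_le_of_overlap_eq_empty (q : ℕ → unitInterval)
    (hqM : ∀ j, M < j → q j = 0) {j : ℕ → ℕ} {E N : Finset (Finset τ)}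
    (hE : ∅ ∉ E) (hN : ∅ ∉ N) (hEN : Disjoint E N)
    (hj : ∀ f ∈ E, f.card ≤ j f.card ∧ j f.card ≤ M)
    {r : ℕ} (hr : ∀ g ∈ N, r ≤ g.card) {ε : ℝ} (hε : 0 < ε)
    (hq : ∀ k, r ≤ k → (q k : ℝ) ≤ 1 - ε) (Φ Ψ : ExtVertex τ M ↪ Fin n)
    (h : overlap Φ Ψ = ∅) :
    (indicatorMeasure q n).real (copyEvent j E N Φ ∩ copyEvent j E N Ψ) ≤
      Real.exp (4 ^ Fintype.card τ * superWeight q M n (r + r) / ε) *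
        ((indicatorMeasure q n).real (copyEvent j E N Φ) *
          (indicatorMeasure q n).real (copyEvent j E N Ψ)) := by
  set K := 4 ^ Fintype.card τ * superWeight q M n (r + r) / ε with hK
  rw [measureReal_copyEvent q hE hN hEN hj, measureReal_copyEvent q hE hN hEN hj,
    copyEvent, copyEvent, cylinder_inter]
  refine (measureReal_cylinder_le q _ _ (by
    simp [empty_notMem_present hE]) (by simp [empty_notMem_absent hN])).trans ?_
  have hdS : Disjoint (present j E Φ) (present j E Ψ) := by
    rw [Finset.disjoint_left]
    intro s hs hs'
    have hne : s ≠ ∅ := fun h0 => empty_notMem_present hE Φ (h0 ▸ hs)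
    obtain ⟨f, -, rfl⟩ := Finset.mem_image.1 hs
    obtain ⟨f', -, h0⟩ := Finset.mem_image.1 hs'
    have := disjoint_map_of_overlap_eq_empty h (extension M j f) (extension M j f')
    rw [h0, disjoint_self] at this
    exact hne this
  rw [Finset.prod_union hdS, present, present, prod_image_map_extension q hj,
    prod_image_map_extension q hj]
  set a := ∏ f ∈ E, (q (j f.card) : ℝ)
  have ha : 0 ≤ a := Finset.prod_nonneg fun f _ => (q _).2.1
  have hbase : Disjoint (base Φ) (base Ψ) := by
    rw [base_eq_map, base_eq_map]; exact disjoint_map_of_overlap_eq_empty h _ _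
  have hint := exp_le_prod_absent_inter q hqM hr hε hq Φ Ψ hbase
  rw [← hK] at hint
  have hui := Finset.prod_union_inter (s₁ := absent N Φ) (s₂ := absent N Ψ)
    (f := fun t => 1 - (q t.card : ℝ))
  have hU : ∏ t ∈ absent N Φ ∪ absent N Ψ, (1 - (q t.card : ℝ)) ≤
      Real.exp K * ((∏ t ∈ absent N Φ, (1 - (q t.card : ℝ))) *
        ∏ t ∈ absent N Ψ, (1 - (q t.card : ℝ))) := by
    rw [← hui]
    have h1 : 1 ≤ Real.exp K * ∏ t ∈ absent N Φ ∩ absent N Ψ, (1 - (q t.card : ℝ)) := by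
      have := mul_le_mul_of_nonneg_left hint (Real.exp_pos K).le
      rwa [← Real.exp_add, add_neg_cancel, Real.exp_zero] at this
    calc _ ≤ (∏ t ∈ absent N Φ ∪ absent N Ψ, (1 - (q t.card : ℝ))) *
          (Real.exp K * ∏ t ∈ absent N Φ ∩ absent N Ψ, (1 - (q t.card : ℝ))) :=
          le_mul_of_one_le_right (prod_one_sub_nonneg q _) h1
      _ = _ := by ring
  calc a * a * ∏ t ∈ absent N Φ ∪ absent N Ψ, (1 - (q t.card : ℝ)) ≤ _ :=
        mul_le_mul_of_nonneg_left hU (mul_nonneg ha ha)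
    _ = _ := by ring

/-- The part of the extended hypergraph that two overlapping copies share has expected number of
copies at least `L`. Its trace on the original vertices is a strong subgraph, and its new
vertices contribute the factors `n ^ (j |f| - |f|)`. -/
theorem le_pow_card_overlap_mul_prod (q : ℕ → unitInterval) {j : ℕ → ℕ} {E : Finset (Finset τ)}
    (hE : ∅ ∉ E) (hj : ∀ f ∈ E, f.card ≤ j f.card ∧ j f.card ≤ M) {L : ℝ} (hn : 1 ≤ n)
    (hLn : L ≤ n)
    (hL : ∀ W : Finset τ, W.Nonempty → ∀ F ⊆ E, (∀ f ∈ F, f ⊆ W) →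
      L ≤ (n : ℝ) ^ W.card * ∏ f ∈ F, ((n : ℝ) ^ (j f.card - f.card) * (q (j f.card) : ℝ)))
    (Φ Ψ : ExtVertex τ M ↪ Fin n) (h : (overlap Φ Ψ).Nonempty) (F : Finset (Finset τ))
    (hF : F ⊆ E) (hFU : ∀ f ∈ F, extension M j f ⊆ overlap Φ Ψ) :
    L ≤ (n : ℝ) ^ (overlap Φ Ψ).card * ∏ f ∈ F, (q (j f.card) : ℝ) := by
  have hn' : (1 : ℝ) ≤ n := by exact_mod_cast hn
  set W : Finset τ := Finset.univ.filter fun v => Sum.inl v ∈ overlap Φ Ψ with hW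
  have hFW : ∀ f ∈ F, f ⊆ W := fun f hf v hv => by
    refine Finset.mem_filter.2 ⟨Finset.mem_univ _, hFU f hf ?_⟩
    simpa [extension] using hv
  rcases W.eq_empty_or_nonempty with h0 | hne
  · have hF0 : F = ∅ := by
      refine Finset.eq_empty_of_forall_notMem fun f hf => ?_
      have : f = ∅ := Finset.subset_empty.1 (h0 ▸ hFW f hf)
      exact hE (this ▸ hF hf)
    rw [hF0, Finset.prod_empty, mul_one]
    exact hLn.trans (le_self_pow₀ hn' h.card_pos.ne')
  · refine (hL W hne F hF hFW).trans ?_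
    rw [Finset.prod_mul_distrib, Finset.prod_pow_eq_pow_sum, ← mul_assoc, ← pow_add]
    refine mul_le_mul_of_nonneg_right (pow_le_pow_right₀ hn' ?_)
      (Finset.prod_nonneg fun f _ => (q _).2.1)
    have hsub : W.disjSum (F.biUnion (extraVertices M j)) ⊆ overlap Φ Ψ := by
      intro b hb
      rcases Finset.mem_disjSum.1 hb with ⟨v, hv, rfl⟩ | ⟨x, hx, rfl⟩
      · exact (Finset.mem_filter.1 hv).2
      · obtain ⟨f, hf, hx⟩ := Finset.mem_biUnion.1 hx
        exact hFU f hf (by simpa [extension] using hx)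
    refine le_trans (le_of_eq ?_) (Finset.card_le_card hsub)
    rw [Finset.card_disjSum, Finset.card_biUnion]
    · congr 1
      exact Finset.sum_congr rfl fun f hf => (card_extraVertices (hj f (hF hf)).2).symm
    · intro f _ f' _ hff
      change Disjoint (extraVertices M j f) (extraVertices M j f')
      rw [Finset.disjoint_left]
      intro x hx hx'
      simp only [extraVertices, Finset.mem_product, Finset.mem_singleton] at hx hx'
      exact hff (hx.1.symm.trans hx'.1)

theorem measureReal_inter_le_of_overlap_nonempty (q : ℕ → unitInterval)
    {j : ℕ → ℕ} {E N : Finset (Finset τ)}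
    (hE : ∅ ∉ E) (hN : ∅ ∉ N) (hj : ∀ f ∈ E, f.card ≤ j f.card ∧ j f.card ≤ M) {L : ℝ}
    (hn : 1 ≤ n) (hL0 : 0 < L) (hLn : L ≤ n)
    (hL : ∀ W : Finset τ, W.Nonempty → ∀ F ⊆ E, (∀ f ∈ F, f ⊆ W) →
      L ≤ (n : ℝ) ^ W.card * ∏ f ∈ F, ((n : ℝ) ^ (j f.card - f.card) * (q (j f.card) : ℝ)))
    (Φ Ψ : ExtVertex τ M ↪ Fin n) (h : (overlap Φ Ψ).Nonempty) :
    (indicatorMeasure q n).real (copyEvent j E N Φ ∩ copyEvent j E N Ψ) ≤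
      (∏ f ∈ E, (q (j f.card) : ℝ)) ^ 2 / L * (n : ℝ) ^ (overlap Φ Ψ).card := by
  rw [copyEvent, copyEvent, cylinder_inter]
  refine (measureReal_cylinder_le q _ _ (by
    simp [empty_notMem_present hE]) (by simp [empty_notMem_absent hN])).trans ?_
  have hnn : ∀ S : Finset (Finset (Fin n)), 0 ≤ ∏ s ∈ S, (q s.card : ℝ) := fun S =>
    Finset.prod_nonneg fun s _ => (q _).2.1
  refine (mul_le_of_le_one_right (hnn _) (prod_one_sub_le_one q _)).trans ?_
  set F := E.filter fun f => (extension M j f).map Ψ ∈ present j E Φ with hF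
  have hinter : present j E Φ ∩ present j E Ψ = F.image fun f => (extension M j f).map Ψ := by
    ext s
    simp only [Finset.mem_inter, Finset.mem_image, hF, Finset.mem_filter]
    constructor
    · rintro ⟨h1, h2⟩
      obtain ⟨f, hf, rfl⟩ := Finset.mem_image.1 h2
      exact ⟨f, ⟨hf, h1⟩, rfl⟩
    · rintro ⟨f, ⟨hf, h1⟩, rfl⟩
      exact ⟨h1, Finset.mem_image_of_mem _ hf⟩
  have hFE : F ⊆ E := Finset.filter_subset _ _
  have hprod := Finset.prod_union_inter (s₁ := present j E Φ) (s₂ := present j E Ψ)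
    (f := fun s => (q s.card : ℝ))
  rw [hinter, prod_image_map_extension q fun f hf => hj f (hFE hf)] at hprod
  have hFU : ∀ f ∈ F, extension M j f ⊆ overlap Φ Ψ := by
    intro f hf b hb
    obtain ⟨f', -, h0⟩ := Finset.mem_image.1 (Finset.mem_filter.1 hf).2
    refine Finset.mem_filter.2 ⟨Finset.mem_univ _, ?_⟩
    have : Ψ b ∈ (extension M j f').map Φ := by
      rw [h0]; exact Finset.mem_map_of_mem _ hb
    exact Finset.map_subset_map.2 (Finset.subset_univ _) this
  have hle := le_pow_card_overlap_mul_prod q hE hj hn hLn hL Φ Ψ h F hFE hFU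
  rw [div_mul_eq_mul_div, le_div_iff₀ hL0]
  refine (mul_le_mul_of_nonneg_left hle (hnn _)).trans (le_of_eq ?_)
  rw [mul_left_comm, hprod, present, present, prod_image_map_extension q hj,
    prod_image_map_extension q hj]
  ring

/-- Weighting each function by a factor `n` for every argument with its value in the image of `Φ`
makes the total weight a product over the arguments. -/
theorem sum_pow_card_overlap_le (Φ : ExtVertex τ M ↪ Fin n) :
    ∑ Ψ : ExtVertex τ M ↪ Fin n, (n : ℝ) ^ (overlap Φ Ψ).card ≤
      (((Fintype.card (ExtVertex τ M) + 1 : ℕ) : ℝ) * n) ^ Fintype.card (ExtVertex τ M) := by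
  set I : Finset (Fin n) := Finset.univ.map Φ with hI
  have h1 : ∀ Ψ : ExtVertex τ M ↪ Fin n, (n : ℝ) ^ (overlap Φ Ψ).card =
      ∏ b, if Ψ b ∈ I then (n : ℝ) else 1 := by
    intro Ψ
    rw [overlap, Finset.prod_ite, Finset.prod_const, Finset.prod_const_one, mul_one]
  let c : (ExtVertex τ M ↪ Fin n) ↪ (ExtVertex τ M → Fin n) :=
    ⟨fun Ψ => Ψ, DFunLike.coe_injective⟩
  calc ∑ Ψ : ExtVertex τ M ↪ Fin n, (n : ℝ) ^ (overlap Φ Ψ).card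
      = ∑ Ψ : ExtVertex τ M ↪ Fin n, ∏ b, (if Ψ b ∈ I then (n : ℝ) else 1) :=
        Finset.sum_congr rfl fun Ψ _ => h1 Ψ
    _ = ∑ g ∈ Finset.univ.map c,
          ∏ b, (if g b ∈ I then (n : ℝ) else 1) := by
        rw [Finset.sum_map]; rfl
    _ ≤ ∑ g : ExtVertex τ M → Fin n, ∏ b, (if g b ∈ I then (n : ℝ) else 1) :=
        Finset.sum_le_sum_of_subset_of_nonneg (Finset.subset_univ _) fun g _ _ =>
          Finset.prod_nonneg fun b _ => by split_ifs <;> positivity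
    _ = (∑ x : Fin n, if x ∈ I then (n : ℝ) else 1) ^ Fintype.card (ExtVertex τ M) := by
        have h := Finset.prod_univ_sum (fun _ : ExtVertex τ M => (Finset.univ : Finset (Fin n)))
          (fun _ x => if x ∈ I then (n : ℝ) else 1)
        rw [Fintype.piFinset_univ] at h
        rw [← h, Finset.prod_const, Finset.card_univ]
    _ ≤ _ := by
        refine pow_le_pow_left₀ (Finset.sum_nonneg fun x _ => by split_ifs <;> positivity) ?_ _
        rw [Finset.sum_ite, Finset.sum_const, Finset.sum_const, nsmul_eq_mul, nsmul_eq_mul, mul_one]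
        have h2 : (Finset.univ.filter (· ∈ I)).card = Fintype.card (ExtVertex τ M) := by
          rw [Finset.filter_mem_eq_inter, Finset.univ_inter, hI, Finset.card_map, Finset.card_univ]
        have h3 : ((Finset.univ.filter (· ∉ I)).card : ℝ) ≤ n := by
          exact_mod_cast (Finset.card_le_univ _).trans_eq (Fintype.card_fin n)
        rw [h2]
        push_cast
        linarith

end Extension

/-! ### The second moment estimate -/

section Extension

set_option linter.unusedSectionVars false

variable {τ : Type*} [Fintype τ] [DecidableEq τ] {M n : ℕ}

theorem half_pow_le_card_embedding (hs : 2 * Fintype.card (ExtVertex τ M) ≤ n) :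
    ((n : ℝ) / 2) ^ Fintype.card (ExtVertex τ M) ≤ Fintype.card (ExtVertex τ M ↪ Fin n) := by
  rw [Fintype.card_embedding_eq, Fintype.card_fin]
  have h := Nat.pow_sub_le_descFactorial n (Fintype.card (ExtVertex τ M))
  refine le_trans ?_ (Nat.cast_le.2 h)
  rw [Nat.cast_pow]
  refine pow_le_pow_left₀ (by positivity) ?_ _
  rw [Nat.cast_sub (by omega)]
  have : (2 : ℝ) * Fintype.card (ExtVertex τ M) ≤ n := by exact_mod_cast hs
  push_cast
  linarith

/-- The second moment estimate for a single `n`. All error terms vanish as `n` and `L` grow while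
`C` and `ε` stay fixed. -/
theorem le_measureReal_iUnion_copyEvent (q : ℕ → unitInterval)
    (hqM : ∀ j, M < j → q j = 0) {j : ℕ → ℕ} {E N : Finset (Finset τ)}
    (hE : ∅ ∉ E) (hEN : Disjoint E N) (hj : ∀ f ∈ E, f.card ≤ j f.card ∧ j f.card ≤ M)
    {r : ℕ} (hr0 : 1 ≤ r) (hr : ∀ g ∈ N, r ≤ g.card) {ε : ℝ} (hε : 0 < ε)
    (hq : ∀ k, r ≤ k → (q k : ℝ) ≤ 1 - ε) {C : ℝ} (hC : superWeight q M n r ≤ C) {L : ℝ}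
    (hn : 1 ≤ n) (hs : 2 * Fintype.card (ExtVertex τ M) ≤ n) (hL0 : 0 < L) (hLn : L ≤ n)
    (hL : ∀ W : Finset τ, W.Nonempty → ∀ F ⊆ E, (∀ f ∈ F, f ⊆ W) →
      L ≤ (n : ℝ) ^ W.card * ∏ f ∈ F, ((n : ℝ) ^ (j f.card - f.card) * (q (j f.card) : ℝ)))
    (hτ : Nonempty τ) :
    2 - Real.exp (4 ^ Fintype.card τ * (C / n) / ε) -
      (4 * ((Fintype.card (ExtVertex τ M) + 1 : ℕ) : ℝ)) ^ Fintype.card (ExtVertex τ M) /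
        Real.exp (-(2 ^ Fintype.card τ * C / ε)) ^ 2 / L ≤
      (indicatorMeasure q n).real (⋃ Φ : ExtVertex τ M ↪ Fin n, copyEvent j E N Φ) := by
  have hN : ∅ ∉ N := fun h => by simpa using hr0.trans (hr _ h)
  have hn' : (1 : ℝ) ≤ n := by exact_mod_cast hn
  have hnpos : (0 : ℝ) < n := by linarith
  set s := Fintype.card (ExtVertex τ M) with hsdef
  set δ := Real.exp (-(2 ^ Fintype.card τ * C / ε)) with hδ
  have hδ0 : 0 < δ := Real.exp_pos _
  set K := 4 ^ Fintype.card τ * (C / n) / ε with hK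
  set a := ∏ f ∈ E, (q (j f.card) : ℝ) with ha
  set μ := indicatorMeasure q n with hμ
  set m := ∑ Φ : ExtVertex τ M ↪ Fin n, μ.real (copyEvent j E N Φ) with hm
  -- The lower bound `hL` for all of `H` forces every required set to have positive probability.
  have ha0 : 0 < a := by
    refine lt_of_le_of_ne (Finset.prod_nonneg fun f _ => (q _).2.1) fun h0 => ?_
    have h := hL Finset.univ Finset.univ_nonempty E subset_rfl fun f _ => Finset.subset_univ f
    rw [Finset.prod_mul_distrib, ← ha, ← h0, mul_zero, mul_zero] at h
    linarith
  have hone : ∀ Φ : ExtVertex τ M ↪ Fin n, a * δ ≤ μ.real (copyEvent j E N Φ) := fun Φ => by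
    rw [hμ, measureReal_copyEvent q hE hN hEN hj]
    refine mul_le_mul_of_nonneg_left (le_trans ?_ (exp_le_prod_absent q hqM hr hε hq Φ)) ha0.le
    refine Real.exp_le_exp.2 (neg_le_neg (div_le_div_of_nonneg_right ?_ hε.le))
    exact mul_le_mul_of_nonneg_left hC (by positivity)
  have hmlow : a * δ * ((n : ℝ) / 2) ^ s ≤ m := by
    calc a * δ * ((n : ℝ) / 2) ^ s
        ≤ a * δ * Fintype.card (ExtVertex τ M ↪ Fin n) :=
          mul_le_mul_of_nonneg_left (half_pow_le_card_embedding hs) (by positivity)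
      _ = ∑ Φ : ExtVertex τ M ↪ Fin n, a * δ := by
          rw [Finset.sum_const, Finset.card_univ, nsmul_eq_mul, mul_comm]
      _ ≤ m := Finset.sum_le_sum fun Φ _ => hone Φ
  have hm0 : 0 < m := lt_of_lt_of_le (by positivity) hmlow
  have hSW : superWeight q M n (r + r) ≤ C / n := by
    rw [le_div_iff₀ hnpos, mul_comm]
    refine le_trans (mul_le_mul_of_nonneg_right (le_self_pow₀ hn' (by omega : r ≠ 0))
      (superWeight_nonneg _ _ _ _)) ((superWeight_add_le q M n r r).trans hC)
  have hpair : ∀ Φ Ψ : ExtVertex τ M ↪ Fin n, μ.real (copyEvent j E N Φ ∩ copyEvent j E N Ψ) ≤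
      Real.exp K * (μ.real (copyEvent j E N Φ) * μ.real (copyEvent j E N Ψ)) +
        a ^ 2 / L * (n : ℝ) ^ (overlap Φ Ψ).card := by
    intro Φ Ψ
    rcases (overlap Φ Ψ).eq_empty_or_nonempty with h | h
    · refine (measureReal_inter_le_of_overlap_eq_empty q hqM hE hN hEN hj hr hε hq Φ Ψ h).trans ?_
      refine le_add_of_le_of_nonneg (mul_le_mul_of_nonneg_right (Real.exp_le_exp.2 ?_)
        (by positivity)) (by positivity)
      exact div_le_div_of_nonneg_right (mul_le_mul_of_nonneg_left hSW (by positivity)) hε.le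
    · refine (measureReal_inter_le_of_overlap_nonempty q hE hN hj hn hL0 hLn hL Φ Ψ h).trans ?_
      exact le_add_of_nonneg_left (by positivity)
  have hcard : (Fintype.card (ExtVertex τ M ↪ Fin n) : ℝ) ≤ (n : ℝ) ^ s := by
    rw [Fintype.card_embedding_eq, Fintype.card_fin]
    exact_mod_cast Nat.descFactorial_le_pow n s
  have hsum : ∑ Φ : ExtVertex τ M ↪ Fin n, ∑ Ψ : ExtVertex τ M ↪ Fin n,
      μ.real (copyEvent j E N Φ ∩ copyEvent j E N Ψ) ≤
      Real.exp K * m ^ 2 + a ^ 2 / L * ((n : ℝ) ^ s * (((s + 1 : ℕ) : ℝ) * n) ^ s) := by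
    calc _ ≤ ∑ Φ : ExtVertex τ M ↪ Fin n, (Real.exp K * (μ.real (copyEvent j E N Φ) * m) +
          a ^ 2 / L * (((s + 1 : ℕ) : ℝ) * n) ^ s) := by
          refine Finset.sum_le_sum fun Φ _ =>
            (Finset.sum_le_sum fun Ψ _ => hpair Φ Ψ).trans ?_
          rw [Finset.sum_add_distrib, ← Finset.mul_sum, ← Finset.mul_sum, ← Finset.mul_sum]
          exact add_le_add le_rfl
            (mul_le_mul_of_nonneg_left (sum_pow_card_overlap_le Φ) (by positivity))
      _ = Real.exp K * m ^ 2 + Fintype.card (ExtVertex τ M ↪ Fin n) *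
          (a ^ 2 / L * (((s + 1 : ℕ) : ℝ) * n) ^ s) := by
          rw [Finset.sum_add_distrib, ← Finset.mul_sum, ← Finset.sum_mul, Finset.sum_const,
            Finset.card_univ, nsmul_eq_mul, ← hm]
          ring
      _ ≤ Real.exp K * m ^ 2 + (n : ℝ) ^ s * (a ^ 2 / L * (((s + 1 : ℕ) : ℝ) * n) ^ s) :=
          add_le_add le_rfl (mul_le_mul_of_nonneg_right hcard (by positivity))
      _ = _ := by ring
  set B := (4 * ((s + 1 : ℕ) : ℝ)) ^ s / δ ^ 2 / L with hB
  have hover : a ^ 2 / L * ((n : ℝ) ^ s * (((s + 1 : ℕ) : ℝ) * n) ^ s) ≤ B * m ^ 2 := by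
    have h1 : (a * δ * ((n : ℝ) / 2) ^ s) ^ 2 ≤ m ^ 2 :=
      pow_le_pow_left₀ (by positivity) hmlow 2
    -- `B` is chosen so that this step is an equality; its factor `4 ^ s` comes from the bound
    -- `(n / 2) ^ s` for the number of embeddings.
    refine le_trans (le_of_eq ?_) (mul_le_mul_of_nonneg_left h1 (by positivity : 0 ≤ B))
    have h4 : (4 : ℝ) ^ s = (2 ^ s) ^ 2 := by rw [← pow_mul, mul_comm, pow_mul]; norm_num
    rw [hB, mul_pow 4, mul_pow _ (n : ℝ), div_pow, h4]
    field_simp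
  have := one_sub_le_measureReal_iUnion μ (fun Φ : ExtVertex τ M ↪ Fin n => copyEvent j E N Φ)
    (fun Φ => Set.Finite.measurableSet (Set.toFinite _)) (Real.exp K - 1 + B) hm0 (by
      refine hsum.trans ((add_le_add le_rfl hover).trans (le_of_eq ?_))
      ring)
  linarith

end Extension

/-! ### Hypergraphs on a subtype and their extended copies -/

section Transfer

variable {α : Type*} {H : Hypergraph α}

/-- A finite set of vertices of `H`, as a set in the ambient type. -/
def vertexImage (H : Hypergraph α) (f : Finset H.vertexSet) : Set α :=
  Subtype.val '' (f : Set H.vertexSet)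

theorem vertexImage_injective : Function.Injective H.vertexImage := fun _ _ h =>
  Finset.coe_injective (Set.image_injective.2 Subtype.val_injective h)

theorem ncard_vertexImage (f : Finset H.vertexSet) : (H.vertexImage f).ncard = f.card := by
  rw [vertexImage, Set.ncard_image_of_injective _ Subtype.val_injective, Set.ncard_coe_finset]

theorem vertexImage_subset (f : Finset H.vertexSet) : H.vertexImage f ⊆ H.vertexSet := by
  rintro _ ⟨x, -, rfl⟩
  exact x.2

theorem exists_vertexImage_eq [Finite H.vertexSet] {e : Set α} (he : e ⊆ H.vertexSet) :
    ∃ f, H.vertexImage f = e := by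
  classical
  have := Fintype.ofFinite H.vertexSet
  refine ⟨(Subtype.val ⁻¹' e : Set H.vertexSet).toFinset, ?_⟩
  rw [vertexImage, Set.coe_toFinset, Subtype.image_preimage_coe, Set.inter_eq_right.2 he]

open Classical in
/-- The edges of `H`, as finite sets of vertices. -/
noncomputable def edgeFinsets (H : Hypergraph α) [Fintype H.vertexSet] :
    Finset (Finset H.vertexSet) :=
  Finset.univ.filter fun f => H.vertexImage f ∈ H.edgeSet

open Classical in
/-- The non-edges of `H`, as finite sets of vertices. -/
noncomputable def nonEdgeFinsets (H : Hypergraph α) [Fintype H.vertexSet] :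
    Finset (Finset H.vertexSet) :=
  Finset.univ.filter fun f => H.vertexImage f ∈ H.nonEdges

theorem mem_edgeFinsets [Fintype H.vertexSet] {f : Finset H.vertexSet} :
    f ∈ H.edgeFinsets ↔ H.vertexImage f ∈ H.edgeSet := by
  simp [edgeFinsets]

theorem mem_nonEdgeFinsets [Fintype H.vertexSet] {f : Finset H.vertexSet} :
    f ∈ H.nonEdgeFinsets ↔ H.vertexImage f ∈ H.nonEdges := by
  simp [nonEdgeFinsets]

/-- The strong subgraph of `H` with vertex set `W` and edge set `F`. -/
def strongSubgraph (H : Hypergraph α) (W : Finset H.vertexSet) (F : Finset (Finset H.vertexSet))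
    (hFW : ∀ f ∈ F, f ⊆ W) : Hypergraph α where
  vertexSet := H.vertexImage W
  edgeSet := H.vertexImage '' (F : Set (Finset H.vertexSet))
  subset_vertexSet_of_mem_edgeSet' := by
    rintro _ ⟨f, hf, rfl⟩
    exact Set.image_mono (Finset.coe_subset.2 (hFW f hf))

theorem edgeCount_strongSubgraph {W : Finset H.vertexSet} {F : Finset (Finset H.vertexSet)}
    (hFW : ∀ f ∈ F, f ⊆ W) (k : ℕ) :
    (H.strongSubgraph W F hFW).edgeCount k = (F.filter fun f => f.card = k).card := by
  have : {e | e ∈ (H.strongSubgraph W F hFW).edgeSet ∧ e.ncard = k} =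
      H.vertexImage '' ((F.filter fun f => f.card = k : Finset (Finset H.vertexSet)) :
        Set (Finset H.vertexSet)) := by
    ext e
    constructor
    · rintro ⟨⟨f, hf, rfl⟩, h⟩
      exact ⟨f, by simpa [ncard_vertexImage] using And.intro hf h, rfl⟩
    · rintro ⟨f, hf, rfl⟩
      have hf' := Finset.mem_filter.1 (Finset.mem_coe.1 hf)
      exact ⟨⟨f, hf'.1, rfl⟩, by rw [ncard_vertexImage]; exact hf'.2⟩
  rw [edgeCount, this, Set.ncard_image_of_injective _ vertexImage_injective, Set.ncard_coe_finset]

theorem muW_strongSubgraph (p : ℕ → ℕ → unitInterval) {M : ℕ} {W : Finset H.vertexSet}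
    {F : Finset (Finset H.vertexSet)} (hFW : ∀ f ∈ F, f ⊆ W)
    (hF : ∀ f ∈ F, 1 ≤ f.card ∧ f.card ≤ M) (n : ℕ) :
    muW p M (H.strongSubgraph W F hFW) n =
      (n : ℝ) ^ W.card * ∏ f ∈ F, superWeight (fun j => p j n) M n f.card := by
  have hv : (H.strongSubgraph W F hFW).vertexSet.ncard = W.card := ncard_vertexImage W
  rw [muW, hv]
  congr 1
  rw [← Finset.prod_fiberwise_of_maps_to (t := Finset.Icc 1 M) (g := Finset.card)
    fun f hf => Finset.mem_Icc.2 (hF f hf)]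
  refine Finset.prod_congr rfl fun k _ => ?_
  rw [edgeCount_strongSubgraph, Finset.prod_congr rfl (g := fun _ => pPrime p M k n) fun f hf => by
    rw [(Finset.mem_filter.1 hf).2]; rfl, Finset.prod_const]

/-- An extended copy of `H` without forbidden traces yields an induced weak copy of `H`. -/
theorem containsInducedWeak_of_mem_copyEvent [Fintype H.vertexSet] [DecidableEq H.vertexSet]
    (hne : H.vertexSet.Nonempty) (hempty : ∅ ∉ H.edgeSet) {M n : ℕ} {j : ℕ → ℕ}
    {Φ : ExtVertex H.vertexSet M ↪ Fin n}
    {ω : {s : Finset (Fin n) // s.Nonempty} → Bool}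
    (hω : ω ∈ copyEvent j H.edgeFinsets H.nonEdgeFinsets Φ) :
    (ofIndicator ω).ContainsInducedWeak H := by
  obtain ⟨x₀, hx₀⟩ := hne
  set φ : α → Fin n := Function.extend Subtype.val (baseEmb Φ) fun _ => baseEmb Φ ⟨x₀, hx₀⟩ with hφ
  have hφv : ∀ v : H.vertexSet, φ v = baseEmb Φ v := fun v =>
    Subtype.val_injective.extend_apply _ _ v
  have himg : ∀ f : Finset H.vertexSet, φ '' H.vertexImage f =
      (f.map (baseEmb Φ) : Set (Fin n)) := by
    intro f
    rw [vertexImage, Set.image_image, Finset.coe_map]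
    exact Set.image_congr fun v _ => hφv v
  have huniv : H.vertexImage Finset.univ = H.vertexSet := by simp [vertexImage]
  have hbase : φ '' H.vertexSet = (base Φ : Set (Fin n)) :=
    (congrArg (φ '' ·) huniv).symm.trans (himg Finset.univ)
  refine ⟨(ofIndicator ω).weakInduced (base Φ : Set (Fin n)), ⟨_, Set.subset_univ _, rfl⟩, φ,
    ?_, ?_⟩
  · intro x hx y hy hxy
    have := (hφv ⟨x, hx⟩).symm.trans (hxy.trans (hφv ⟨y, hy⟩))
    exact congrArg Subtype.val ((baseEmb Φ).injective this)
  refine Hypergraph.ext hbase ?_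
  ext e
  constructor
  · rintro ⟨e, he, rfl⟩
    obtain ⟨f, rfl⟩ := exists_vertexImage_eq (H.subset_vertexSet_of_mem_edgeSet' he)
    have hf : f.Nonempty := by
      rw [Finset.nonempty_iff_ne_empty]
      rintro rfl
      exact hempty (by simpa [vertexImage] using he)
    have hne' : ((extension M j f).map Φ).Nonempty := (extension_nonempty hf).map
    refine ⟨by rw [himg]; exact_mod_cast hf.map, (extension M j f).map Φ,
      ⟨⟨_, hne'⟩, (hω ⟨_, hne'⟩).1 (Finset.mem_image_of_mem _ (mem_edgeFinsets.2 he)), rfl⟩, ?_⟩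
    rw [himg, ← Finset.coe_inter, map_extension_inter_base]
  · rintro ⟨hne', _, ⟨s, hs, rfl⟩, rfl⟩
    have hsub : Subtype.val '' (baseEmb Φ ⁻¹' (s.1 : Set (Fin n))) ⊆ H.vertexSet := by
      rintro _ ⟨v, -, rfl⟩; exact v.2
    obtain ⟨f, hf⟩ := exists_vertexImage_eq hsub
    have hfm : (f.map (baseEmb Φ) : Set (Fin n)) = (s.1 : Set (Fin n)) ∩ base Φ := by
      rw [← himg, hf, Set.image_image, Set.image_congr fun v _ => hφv v,
        Set.image_preimage_eq_inter_range, base, Finset.coe_map, Finset.coe_univ, Set.image_univ]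
    refine ⟨H.vertexImage f, ?_, by rw [himg, hfm]⟩
    by_contra hcon
    have hN : f ∈ H.nonEdgeFinsets := by
      refine mem_nonEdgeFinsets.2 ⟨vertexImage_subset f, ?_, hcon⟩
      rw [← hfm, ← himg] at hne'
      exact hne'.of_image
    have habs : s.1 ∈ absent H.nonEdgeFinsets Φ :=
      Finset.mem_filter.2 ⟨Finset.mem_univ _, f, hN, by
        rw [← Finset.coe_inj, Finset.coe_inter, hfm]⟩
    simp [(hω s).2 habs] at hs

end Transfer

/-- One of the at most `M + 1` terms of the sum has at least the average size. -/
theorem exists_superWeight_le (q : ℕ → unitInterval) {M n k : ℕ} (hkM : k ≤ M) :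
    ∃ j, k ≤ j ∧ j ≤ M ∧ superWeight q M n k ≤ (M + 1 : ℝ) * ((n : ℝ) ^ (j - k) * (q j : ℝ)) := by
  obtain ⟨j, hj, hmax⟩ := Finset.exists_max_image (Finset.Icc k M)
    (fun j => (n : ℝ) ^ (j - k) * (q j : ℝ)) ⟨k, Finset.mem_Icc.2 ⟨le_rfl, hkM⟩⟩
  refine ⟨j, (Finset.mem_Icc.1 hj).1, (Finset.mem_Icc.1 hj).2, ?_⟩
  refine (Finset.sum_le_card_nsmul _ _ _ hmax).trans ?_
  rw [nsmul_eq_mul, Nat.card_Icc]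
  refine mul_le_mul_of_nonneg_right ?_ (mul_nonneg (by positivity) (q j).2.1)
  exact_mod_cast Nat.sub_le _ _

/-! ### Copies in the random hypergraph -/

/-- The second moment estimate in terms of `muW`: for each size `k` of edges, the extended size
`j k` is one that contributes most to `pPrime p M k n`. -/
theorem le_random_containsInducedWeak {α : Type*} (H : Hypergraph α) [Fintype H.vertexSet]
    (hne : H.vertexSet.Nonempty) (hempty : ∅ ∉ H.edgeSet) {M : ℕ}
    (hHM : ∀ e ∈ H.edgeSet, e.ncard ≤ M) (p : ℕ → ℕ → unitInterval)
    (hpM : ∀ r n, M < r → p r n = 0) {r : ℕ} (hr : IsLeast (Set.ncard '' H.nonEdges) r)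
    {ε : ℝ} (hε : 0 < ε) {n : ℕ} (hq : ∀ k, r ≤ k → (p k n : ℝ) ≤ 1 - ε) {C : ℝ}
    (hC : pPrime p M r n ≤ C) {L : ℝ} (hn : 1 ≤ n)
    (hs : 2 * Fintype.card (ExtVertex H.vertexSet M) ≤ n) (hL0 : 0 < L) (hLn : L ≤ n)
    (hL : ∀ (W : Finset H.vertexSet) (F : Finset (Finset H.vertexSet)) (hFW : ∀ f ∈ F, f ⊆ W),
      W.Nonempty → F ⊆ H.edgeFinsets →
      L * (M + 1 : ℝ) ^ H.edgeFinsets.card ≤ muW p M (H.strongSubgraph W F hFW) n) :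
    2 - Real.exp (4 ^ Fintype.card H.vertexSet * (C / n) / ε) -
      (4 * ((Fintype.card (ExtVertex H.vertexSet M) + 1 : ℕ) : ℝ)) ^
          Fintype.card (ExtVertex H.vertexSet M) /
        Real.exp (-(2 ^ Fintype.card H.vertexSet * C / ε)) ^ 2 / L ≤
      (random p n).real {G | G.ContainsInducedWeak H} := by
  classical
  set E := H.edgeFinsets with hE
  have hEcard : ∀ f ∈ E, 1 ≤ f.card ∧ f.card ≤ M := fun f hf => by
    refine ⟨Finset.card_pos.2 (Finset.nonempty_iff_ne_empty.2 ?_), ?_⟩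
    · rintro rfl
      exact hempty (by simpa [vertexImage] using mem_edgeFinsets.1 hf)
    · rw [← ncard_vertexImage]; exact hHM _ (mem_edgeFinsets.1 hf)
  have hEempty : ∅ ∉ E := fun h => by simpa using (hEcard _ h).1
  have hex : ∀ k, ∃ j, k ≤ M → k ≤ j ∧ j ≤ M ∧ superWeight (fun i => p i n) M n k ≤
      (M + 1 : ℝ) * ((n : ℝ) ^ (j - k) * (p j n : ℝ)) := fun k => by
    by_cases hk : k ≤ M
    · obtain ⟨j, hj⟩ := exists_superWeight_le (fun i => p i n) (n := n) hk
      exact ⟨j, fun _ => hj⟩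
    · exact ⟨0, fun h => absurd h hk⟩
  choose j hj using hex
  have hr0 : 1 ≤ r := by
    obtain ⟨e, ⟨heV, hene, -⟩, rfl⟩ := hr.1
    exact (Set.ncard_pos ((Set.toFinite H.vertexSet).subset heV)).2 hene
  have hrN : ∀ g ∈ H.nonEdgeFinsets, r ≤ g.card := fun g hg => by
    rw [← ncard_vertexImage]
    exact hr.2 ⟨_, mem_nonEdgeFinsets.1 hg, rfl⟩
  have hEN : Disjoint E H.nonEdgeFinsets := Finset.disjoint_left.2 fun f h1 h2 =>
    (mem_nonEdgeFinsets.1 h2).2.2 (mem_edgeFinsets.1 h1)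
  have hL' : ∀ W : Finset H.vertexSet, W.Nonempty → ∀ F ⊆ E, (∀ f ∈ F, f ⊆ W) →
      L ≤ (n : ℝ) ^ W.card *
        ∏ f ∈ F, ((n : ℝ) ^ (j f.card - f.card) * (p (j f.card) n : ℝ)) := by
    intro W hW F hF hFW
    have h1 := hL W F hFW hW hF
    rw [muW_strongSubgraph p hFW fun f hf => hEcard f (hF hf)] at h1
    have hM1 : (1 : ℝ) ≤ M + 1 := by linarith [Nat.cast_nonneg (α := ℝ) M]
    have hP : 0 ≤ ∏ f ∈ F, ((n : ℝ) ^ (j f.card - f.card) * (p (j f.card) n : ℝ)) :=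
      Finset.prod_nonneg fun f _ => mul_nonneg (by positivity) (p _ n).2.1
    have h2 : ∏ f ∈ F, superWeight (fun j => p j n) M n f.card ≤ (M + 1 : ℝ) ^ E.card *
        ∏ f ∈ F, ((n : ℝ) ^ (j f.card - f.card) * (p (j f.card) n : ℝ)) := by
      refine (Finset.prod_le_prod (fun f _ => superWeight_nonneg _ _ _ _)
        fun f hf => (hj f.card (hEcard f (hF hf)).2).2.2).trans ?_
      rw [Finset.prod_mul_distrib, Finset.prod_const]
      exact mul_le_mul_of_nonneg_right (pow_le_pow_right₀ hM1 (Finset.card_le_card hF)) hP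
    have h3 := h1.trans (mul_le_mul_of_nonneg_left h2 (by positivity))
    rw [mul_left_comm, mul_comm L] at h3
    exact le_of_mul_le_mul_left h3 (by positivity)
  refine (le_measureReal_iUnion_copyEvent (fun k => p k n) (fun k hk => hpM k n hk) hEempty hEN
    (fun f hf => ⟨(hj _ (hEcard f hf).2).1, (hj _ (hEcard f hf).2).2.1⟩) hr0 hrN hε hq hC hn hs
    hL0 hLn hL' hne.to_subtype).trans ?_
  have hmap : (random p n).real {G | G.ContainsInducedWeak H} =
      (indicatorMeasure (fun k => p k n) n).real
        (ofIndicator ⁻¹' {G | G.ContainsInducedWeak H}) :=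
    map_measureReal_apply (measurable_of_finite _) MeasurableSpace.measurableSet_top
  rw [hmap]
  refine measureReal_mono (Set.iUnion_subset fun Φ ω hω => ?_)
  exact containsInducedWeak_of_mem_copyEvent hne hempty hω

/-- Beyond the size `r`, edge probabilities are `O(1 / n)`. -/
theorem mul_le_pPrime (p : ℕ → ℕ → unitInterval) {M r k n : ℕ} (hpM : ∀ r n, M < r → p r n = 0)
    (hn : 1 ≤ n) (hk : r < k) : (n : ℝ) * (p k n : ℝ) ≤ pPrime p M r n := by
  have hn' : (1 : ℝ) ≤ n := by exact_mod_cast hn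
  by_cases hkM : k ≤ M
  · refine (mul_le_mul_of_nonneg_right (le_self_pow₀ hn' (by omega : k - r ≠ 0))
      (p k n).2.1).trans ?_
    exact Finset.single_le_sum (f := fun j => (n : ℝ) ^ (j - r) * (p j n : ℝ))
      (fun j _ => mul_nonneg (by positivity) (p j n).2.1) (Finset.mem_Icc.2 ⟨hk.le, hkM⟩)
  · rw [hpM k n (not_le.1 hkM)]
    have h : 0 ≤ pPrime p M r n := superWeight_nonneg (fun j => p j n) M n r
    simpa using h

end Hypergraph

theorem mainTheorem4 {α : Type*} (H : Hypergraph α)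
    (hfin : H.vertexSet.Finite) (hne : H.vertexSet.Nonempty) (hempty : ∅ ∉ H.edgeSet)
    (M : ℕ) (hHM : ∀ e ∈ H.edgeSet, e.ncard ≤ M)
    (p : ℕ → ℕ → unitInterval) (hpM : ∀ r n, M < r → p r n = 0)
    (r : ℕ) (hr : IsLeast (Set.ncard '' H.nonEdges) r)
    (ε : ℝ) (hε : 0 < ε) (hpr : ∀ᶠ n in atTop, (p r n : ℝ) ≤ 1 - ε)
    (hpr' : (fun n : ℕ => Hypergraph.pPrime p M r n) =O[atTop] (fun _ => (1 : ℝ)))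
    (hmu : ∀ H' : Hypergraph α, H'.vertexSet.Nonempty → H'.IsStrongSubgraph H →
      Tendsto (fun n : ℕ => Hypergraph.muW p M H' n) atTop atTop) :
    Tendsto (fun n : ℕ => Hypergraph.random p n {G | G.ContainsInducedWeak H}) atTop (𝓝 1) := by
  classical
  have : Fintype H.vertexSet := hfin.fintype
  suffices hreal : Tendsto (fun n : ℕ =>
      (Hypergraph.random p n).real {G | G.ContainsInducedWeak H}) atTop (𝓝 1) by
    refine (ENNReal.tendsto_toReal_iff (fun n => measure_ne_top _ _) ENNReal.one_ne_top).1 ?_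
    rwa [ENNReal.toReal_one]
  obtain ⟨C, hC0, hC⟩ := hpr'.exists_pos
  -- Shrinking `ε` to at most `1 / 2` makes it a bound for the sizes above `r` as well.
  set ε' := min ε (1 / 2) with hε'
  have hε'0 : 0 < ε' := by positivity
  set B := (4 * ((Fintype.card (Hypergraph.ExtVertex H.vertexSet M) + 1 : ℕ) : ℝ)) ^
      Fintype.card (Hypergraph.ExtVertex H.vertexSet M) /
    Real.exp (-(2 ^ Fintype.card H.vertexSet * C / ε')) ^ 2 with hB
  have hB0 : 0 < B := by positivity
  refine tendsto_order.2 ⟨fun a ha => ?_, fun a ha =>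
    Eventually.of_forall fun n => measureReal_le_one.trans_lt ha⟩
  set η := 1 - a with hη
  have hη0 : 0 < η := by linarith
  set L := 2 * B / η with hL
  have hL0 : 0 < L := by positivity
  have hexp : Tendsto (fun n : ℕ => Real.exp (4 ^ Fintype.card H.vertexSet * (C / n) / ε'))
      atTop (𝓝 1) := by
    have h1 : Tendsto (fun n : ℕ => C / (n : ℝ)) atTop (𝓝 0) :=
      tendsto_const_div_atTop_nhds_zero_nat C
    have h2 := (h1.const_mul ((4 : ℝ) ^ Fintype.card H.vertexSet)).div_const ε'
    rw [mul_zero, zero_div] at h2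
    have h3 := (Real.continuous_exp.tendsto 0).comp h2
    rwa [Real.exp_zero] at h3
  have hmuL : ∀ᶠ n : ℕ in atTop, ∀ (W : Finset H.vertexSet) (F : Finset (Finset H.vertexSet))
      (hFW : ∀ f ∈ F, f ⊆ W), W.Nonempty → F ⊆ H.edgeFinsets →
      L * (M + 1 : ℝ) ^ H.edgeFinsets.card ≤
        Hypergraph.muW p M (H.strongSubgraph W F hFW) n := by
    refine eventually_all.2 fun W => eventually_all.2 fun F => ?_
    by_cases h : (∀ f ∈ F, f ⊆ W) ∧ W.Nonempty ∧ F ⊆ H.edgeFinsets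
    · obtain ⟨hFW, hW, hF⟩ := h
      have hstrong : (H.strongSubgraph W F hFW).IsStrongSubgraph H := by
        refine ⟨Hypergraph.vertexImage_subset W, ?_⟩
        rintro _ ⟨f, hf, rfl⟩
        exact Hypergraph.mem_edgeFinsets.1 (hF hf)
      have hWne : (H.strongSubgraph W F hFW).vertexSet.Nonempty :=
        Set.Nonempty.image _ (Finset.coe_nonempty.2 hW)
      filter_upwards [(hmu _ hWne hstrong).eventually_ge_atTop
        (L * (M + 1 : ℝ) ^ H.edgeFinsets.card)] with n hn _ _ _ using hn
    · exact Eventually.of_forall fun n hFW hW hF => absurd ⟨hFW, hW, hF⟩ h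
  filter_upwards [hpr, hC.bound, hmuL, hexp.eventually_lt_const (by linarith : 1 < 1 + η / 2),
    eventually_ge_atTop 1,
    eventually_ge_atTop (2 * Fintype.card (Hypergraph.ExtVertex H.vertexSet M)),
    tendsto_natCast_atTop_atTop.eventually_ge_atTop L,
    tendsto_natCast_atTop_atTop.eventually_ge_atTop (2 * C)]
    with n hprn hCn hmun hexpn hn hs hLn hCn2
  have hCn' : Hypergraph.pPrime p M r n ≤ C := by
    simpa using (le_abs_self _).trans hCn
  have hq : ∀ k, r ≤ k → (p k n : ℝ) ≤ 1 - ε' := by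
    intro k hk
    rcases hk.eq_or_lt with rfl | hk
    · linarith [min_le_left ε (1 / 2)]
    · have h1 := (Hypergraph.mul_le_pPrime p hpM hn hk).trans hCn'
      have h2 : (n : ℝ) * (p k n : ℝ) ≤ n * (1 / 2) := by linarith
      have h3 := le_of_mul_le_mul_left h2 (by exact_mod_cast hn)
      linarith [min_le_right ε (1 / 2)]
  have hmain := Hypergraph.le_random_containsInducedWeak H hne hempty hHM p hpM hr hε'0 hq hCn' hn
    hs hL0 hLn hmun
  rw [← hB] at hmain
  have hBL : B / L = η / 2 := by rw [hL]; field_simp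
  rw [hBL] at hmain
  linarith
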